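/- A \emph{set system} $D=(E,\mathcal F)$ is a finite set $E$ with a collection $\mathcal F$ of subsets of $E$ (the feasible sets). For $e\in E$, call $e$ a coloop if it is in every feasible set and a loop if it is in no feasible set. If $e$ is not a coloop, let $D\setminus e=(E-e,\{F\in\mathcal F\mid F\subseteq E-e\})$; if $e$ is not a loop, let $D/e=(E-e,\{F-e\mid F\in\mathcal F,\ e\in F\})$; if $e$ is a loop or a coloop, then $D\setminus e$ and $D/e$ both denote the one of these that is defined. A \emph{minor} of $D$ is a set system obtained from $D$ by a sequence of deletions and contractions of elements. A \emph{ribbon graph} $G=(V,E)$ is a surface with boundary, represented as the union of a finite set $V$ of discs (vertices) and a finite set $E$ of discs (edges), where the vertices and edges intersect in disjoint line segments, each such segment lies on the boundary of precisely one vertex and precisely one edge, and every edge contains exactly two such segments. Ribbon graphs are considered up to homeomorphisms that preserve vertices, edges and edge labels. For $A\subseteq E$, let $f(A)$ be the number of boundary components of the spanning ribbon subgraph $(V,A)$, and let $k(G)$ be the number of connected components of $G$. Let $D(G)=(E,\mathcal F(G))$ with $\mathcal F(G)=\{A\subseteq E\mid f(A)=k(G)\}$, the delta-matroid whose feasible sets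 are the edge sets of the spanning quasi-trees of $G$. For an edge $e$ with incident vertices $u,v$ (possibly equal), $G\setminus e=(V,E-e)$, and $G/e$ is obtained by attaching a disc (a new vertex) along each boundary component of $e\cup u\cup v$ and then deleting $e$, $u$ and $v$. A \emph{minor} of $G$ is a ribbon graph obtained from $G$ by a sequence of edge deletions, edge contractions and vertex deletions (a vertex being deleted together with its incident edges). \textbf{Proposition.} Let $G$ be a ribbon graph. \begin{enumerate} \item For every edge $e$ of $G$, $D(G\setminus e)=D(G)\setminus e$ and $D(G/e)=D(G)/e$. \item If a ribbon graph $H$ is a minor of $G$, then $D(H)$ is a minor of $D(G)$. \end{enumerate} -/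

import Mathlib

/-! ## Set systems, deletion, contraction and minors -/

/-- A set system `(E, 𝓕)`: a finite ground set `E` and a collection `𝓕` of subsets of `E`. -/
@[ext]
structure SetSystem (α : Type*) where
  ground : Finset α
  feasible : Set (Finset α)
  subset_ground : ∀ F ∈ feasible, F ⊆ ground

namespace SetSystem

variable {α : Type*}

/-- `e` is a loop of `D` if it is an element of the ground set in no feasible set. -/
def IsLoop (D : SetSystem α) (e : α) : Prop := e ∈ D.ground ∧ ∀ F ∈ D.feasible, e ∉ F

/-- `e` is a coloop of `D` if it is an element of the ground set in every feasible set. -/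
def IsColoop (D : SetSystem α) (e : α) : Prop := e ∈ D.ground ∧ ∀ F ∈ D.feasible, e ∈ F

variable [DecidableEq α]

/-- `(E - e, {F | F ∈ 𝓕, F ⊆ E - e})`. -/
def avoiding (D : SetSystem α) (e : α) : SetSystem α where
  ground := D.ground.erase e
  feasible := {F | F ∈ D.feasible ∧ F ⊆ D.ground.erase e}
  subset_ground := fun _ hF => hF.2

/-- `(E - e, {F - e | F ∈ 𝓕, e ∈ F})`. -/
def through (D : SetSystem α) (e : α) : SetSystem α where
  ground := D.ground.erase e
  feasible := {X | ∃ F ∈ D.feasible, e ∈ F ∧ X = F.erase e}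
  subset_ground := by
    rintro X ⟨F, hF, -, rfl⟩
    exact Finset.erase_subset_erase e (D.subset_ground F hF)

open Classical in
/-- `D ∖ e`: the feasible sets that avoid `e`, unless `e` is a coloop, when `D ∖ e = D / e`. -/
noncomputable def delete (D : SetSystem α) (e : α) : SetSystem α :=
  if D.IsColoop e then D.through e else D.avoiding e

open Classical in
/-- `D / e`: the sets `F - e` with `F` feasible and `e ∈ F`, unless `e` is a loop, when
`D / e = D ∖ e`. -/
noncomputable def contract (D : SetSystem α) (e : α) : SetSystem α :=
  if D.IsLoop e then D.avoiding e else D.through e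

/-- `IsMinor D' D`: the system `D'` is obtained from `D` by a sequence of deletions and
contractions of elements. -/
inductive IsMinor : SetSystem α → SetSystem α → Prop
  | refl (D : SetSystem α) : IsMinor D D
  | delete {D' D : SetSystem α} (h : IsMinor D' D) (e : α) (he : e ∈ D'.ground) :
      IsMinor (D'.delete e) D
  | contract {D' D : SetSystem α} (h : IsMinor D' D) (e : α) (he : e ∈ D'.ground) :
      IsMinor (D'.contract e) D

end SetSystem

/-! ## Ribbon graphs

An edge of a ribbon graph is a disc, viewed as a rectangle. Two opposite sides of the rectangle are
the line segments (the two *ends*, numbered by `Bool`) in which it meets the vertices; the other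
two sides (numbered by `Bool` too) lie on the boundary of the surface. The corner `(e, i, s)` of
the edge `e` is the point in which its end `i` meets its side `s`.

The boundary circle of a vertex that is met by at least one edge consists alternately of ends of
edges and of free arcs. A free arc joins two different corners, and each corner is an endpoint of
exactly one free arc. Hence the free arcs form a fixed-point-free involution of the set of
corners, and every such involution arises, the vertex boundaries being the closed curves that
run alternately along free arcs and ends. Up to a homeomorphism that preserves vertices and
edges, a ribbon graph is therefore given by its set of edges, this involution, and the number of
its isolated vertices. -/

/-- A corner `(e, i, s)`: the point where end `i` and side `s` of the edge `e` meet. -/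
abbrev Corner (α : Type*) := α × Bool × Bool

namespace Corner

variable {α : Type*}

/-- The other corner on the same end of the edge, that is, on the same line segment between the
edge and a vertex. -/
def acrossEnd (x : Corner α) : Corner α := (x.1, x.2.1, !x.2.2)

/-- The other corner on the same side of the edge. -/
def alongSide (x : Corner α) : Corner α := (x.1, !x.2.1, x.2.2)

/-- A way to pair off the four corners of each edge. -/
structure IsPairing (link : Corner α → Corner α) : Prop where
  edge : ∀ x, (link x).1 = x.1
  invol : ∀ x, link (link x) = x
  ne : ∀ x, link x ≠ x

theorem isPairing_acrossEnd : IsPairing (acrossEnd : Corner α → Corner α) where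
  edge _ := rfl
  invol _ := by simp [acrossEnd]
  ne x := by
    rcases x with ⟨e, i, s⟩
    cases s <;> simp [acrossEnd]

theorem isPairing_alongSide : IsPairing (alongSide : Corner α → Corner α) where
  edge _ := rfl
  invol _ := by simp [alongSide]
  ne x := by
    rcases x with ⟨e, i, s⟩
    cases i <;> simp [alongSide]

/-- The four corners of an edge are the members of two linked pairs. -/
theorem IsPairing.eq_or {e : α} {link : Corner α → Corner α} (hl : IsPairing link)
    {y y' z : Corner α} (hy : y.1 = e) (hy' : y'.1 = e) (hz : z.1 = e) (h : y' ≠ y)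
    (h' : y' ≠ link y) : z = y ∨ z = link y ∨ z = y' ∨ z = link y' := by
  have k1 : (link y).1 = e := (hl.edge y).trans hy
  have k2 : (link y').1 = e := (hl.edge y').trans hy'
  have n1 := hl.ne y
  have n2 := hl.ne y'
  have n3 : link y' ≠ y := fun hc => h' (by rw [← hc, hl.invol])
  have n4 : link y' ≠ link y := fun hc => h (by rw [← hl.invol y', hc, hl.invol])
  generalize link y = u at *
  generalize link y' = v at *
  obtain ⟨e1, p1⟩ := y
  obtain ⟨e2, p2⟩ := y'
  obtain ⟨e3, p3⟩ := z
  obtain ⟨e4, p4⟩ := u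
  obtain ⟨e5, p5⟩ := v
  simp only at hy hy' hz k1 k2
  subst hy hy' hz k1 k2
  simp only [ne_eq, Prod.mk.injEq, true_and] at *
  by_contra hc
  push Not at hc
  have hnd : [p3, p1, p4, p2, p5].Nodup := by
    simp only [List.nodup_cons, List.mem_cons, List.not_mem_nil, not_or]
    grind
  have := hnd.length_le_card
  simp at this

end Corner

/-- A (finite) ribbon graph whose edges are labelled by elements of `α`. The free arc of a vertex
boundary that starts at the corner `x` of an edge ends at the corner `arc x`; the corners of
elements of `α` that are not edges are fixed by convention. -/
structure RibbonGraph (α : Type*) where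
  edges : Finset α
  arc : Corner α → Corner α
  arc_invol : ∀ x, arc (arc x) = x
  arc_eq_self_iff : ∀ x, arc x = x ↔ x.1 ∉ edges
  /-- the number of isolated vertices -/
  isolated : ℕ

namespace RibbonGraph

variable {α : Type*}

/-- The corners of the edges of `G`. -/
abbrev Corners (G : RibbonGraph α) := {x : Corner α // x.1 ∈ G.edges}

/-- One step along the boundary of a vertex. -/
def VertexStep (G : RibbonGraph α) (x y : G.Corners) : Prop :=
  y.1 = G.arc x.1 ∨ y.1 = x.1.acrossEnd

/-- One step along the boundary of a vertex or of an edge. -/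
def ComponentStep (G : RibbonGraph α) (x y : G.Corners) : Prop :=
  y.1 = G.arc x.1 ∨ y.1 = x.1.acrossEnd ∨ y.1 = x.1.alongSide

/-- One step along the boundary of the spanning ribbon subgraph `(V, A)`: it follows the free arcs
of the vertices, the sides of the edges in `A`, and the line segments in which the removed
edges met the vertices. -/
def BoundaryStep (G : RibbonGraph α) (A : Finset α) (x y : G.Corners) : Prop :=
  y.1 = G.arc x.1 ∨ (x.1.1 ∈ A ∧ y.1 = x.1.alongSide) ∨ (x.1.1 ∉ A ∧ y.1 = x.1.acrossEnd)

/-- The vertices: the closed curves formed by free arcs and ends of edges, and the isolated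
vertices. -/
def Vertex (G : RibbonGraph α) := Quot G.VertexStep ⊕ Fin G.isolated

/-- `k(G)`, the number of connected components. -/
noncomputable def k (G : RibbonGraph α) : ℕ := Nat.card (Quot G.ComponentStep) + G.isolated

/-- `f(A)`, the number of boundary components of the spanning ribbon subgraph `(V, A)`. -/
noncomputable def f (G : RibbonGraph α) (A : Finset α) : ℕ :=
  Nat.card (Quot (G.BoundaryStep A)) + G.isolated

/-- `D(G) = (E, 𝓕)`, where `𝓕 = {A ⊆ E | f(A) = k(G)}` consists of the edge sets of the spanning
quasi-trees of `G`. -/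
noncomputable def D (G : RibbonGraph α) : SetSystem α where
  ground := G.edges
  feasible := {A | A ⊆ G.edges ∧ G.f A = G.k}
  subset_ground := fun _ hA => hA.1

variable [DecidableEq α]

/-! ### Deletion and contraction of an edge

In `G ∖ e` and in `G / e` the edge `e` is removed, and the vertex boundaries are replaced by new
closed curves. In `G ∖ e` these are the old ones, which run along the ends of `e`, now parts of
free arcs. In `G / e` they are the boundary curves of the union of `e` with its incident vertices
(and the boundaries of the other vertices), which run along the sides of `e`. In both cases a new
free arc starts along an old one; whenever it arrives at a corner of `e`, it passes to the corner
of `e` that is linked to it and continues along the old free arc there. The new curves that meet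
no edge other than `e` bound new isolated vertices. -/

/-- A curve that has arrived at a corner `y` of `e` passes through `e` to the linked corner and on
along the next free arc. -/
def pass (G : RibbonGraph α) (e : α) (link : Corner α → Corner α) (y : Corner α) : Corner α :=
  if y.1 = e then G.arc (link y) else y

/-- The new free arcs. As `e` has only four corners, an arc passes through `e` at most twice. -/
def spliceArc (G : RibbonGraph α) (e : α) (link : Corner α → Corner α) (x : Corner α) :
    Corner α :=
  if x.1 = e then x else G.pass e link (G.pass e link (G.arc x))

/-- One step along a free arc or through `e`. -/
def SpliceStep (G : RibbonGraph α) (e : α) (link : Corner α → Corner α) (x y : G.Corners) :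
    Prop :=
  y.1 = G.arc x.1 ∨ (x.1.1 = e ∧ y.1 = link x.1)

/-- The number of the closed curves formed by free arcs and passages through `e` that meet no edge
other than `e`. -/
noncomputable def closedCurves (G : RibbonGraph α) (e : α) (link : Corner α → Corner α) : ℕ :=
  Nat.card {c : Quot (G.SpliceStep e link) // ∀ x, Quot.mk _ x = c → x.1.1 = e}

theorem spliceArc_of_notMem (G : RibbonGraph α) (e : α) (link : Corner α → Corner α)
    {x : Corner α} (hx : x.1 ∉ G.edges) : G.spliceArc e link x = x := by
  have h := (G.arc_eq_self_iff x).2 hx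
  by_cases hxe : x.1 = e
  · simp [spliceArc, hxe]
  · simp [spliceArc, pass, h, hxe]

theorem spliceArc_spec (G : RibbonGraph α) (e : α) {link : Corner α → Corner α}
    (hl : Corner.IsPairing link) {x : Corner α} (hx : x.1 ≠ e) (hE : x.1 ∈ G.edges) :
    (G.spliceArc e link x).1 ≠ e ∧ G.spliceArc e link x ≠ x ∧
      G.spliceArc e link (G.spliceArc e link x) = x := by
  have inv := G.arc_invol
  have nex : ∀ z : Corner α, z.1 = e → z ≠ x := fun z hz hc => hx (hc ▸ hz)
  have fix : ∀ z : Corner α, G.arc z = z → z.1 ∉ G.edges := fun z => (G.arc_eq_self_iff z).1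
  have arcx : G.arc x ≠ x := fun h => fix x h hE
  by_cases h1 : (G.arc x).1 = e
  · have mem : e ∈ G.edges := by
      by_contra hc
      have := (G.arc_eq_self_iff (G.arc x)).2 (h1 ▸ hc)
      rw [inv] at this
      exact arcx this.symm
    have fpf : ∀ z : Corner α, z.1 = e → G.arc z ≠ z := fun z hz h => fix z h (hz ▸ mem)
    have hly : (link (G.arc x)).1 = e := (hl.edge _).trans h1
    by_cases h2 : (G.arc (link (G.arc x))).1 = e
    · set y := G.arc x with hy
      set y' := G.arc (link y) with hy'
      have hay : G.arc y = x := inv x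
      have hay' : G.arc y' = link y := inv _
      have hly' : (link y').1 = e := (hl.edge _).trans h2
      have d1 : y' ≠ y := fun hc => nex _ hly (by rw [← hay', hc, hay])
      have d2 : y' ≠ link y := fpf _ hly
      have h3 : (G.arc (link y')).1 ≠ e := by
        intro h3
        rcases hl.eq_or h1 h2 h3 d1 d2 with h | h | h | h
        · exact nex _ hly' (by rw [← inv (link y'), h, hay])
        · exact hl.ne y' (by rw [← inv (link y'), h])
        · exact d1 (by rw [← hl.invol y', ← inv (link y'), h, hay', hl.invol])
        · exact fpf _ hly' h
      have hS : G.spliceArc e link x = G.arc (link y') := by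
        simp only [spliceArc, pass, if_neg hx, ← hy, if_pos h1, ← hy', if_pos h2]
      refine ⟨hS ▸ h3, fun hc => ?_, ?_⟩
      · rw [hS] at hc
        have : link y' = y := by rw [← inv (link y'), hc]
        exact d2 (by rw [← this, hl.invol])
      · rw [hS]
        simp only [spliceArc, pass, if_neg h3, inv, if_pos hly', hl.invol, hay', if_pos hly, hay]
    · have hS : G.spliceArc e link x = G.arc (link (G.arc x)) := by
        simp only [spliceArc, pass, if_neg hx, if_pos h1, if_neg h2]
      refine ⟨hS ▸ h2, fun hc => ?_, ?_⟩
      · rw [hS] at hc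
        exact hl.ne (G.arc x) (by rw [← inv (link (G.arc x)), hc])
      · rw [hS]
        simp only [spliceArc, pass, if_neg h2, inv, if_pos hly, hl.invol, if_neg hx]
  · have hS : G.spliceArc e link x = G.arc x := by
      simp only [spliceArc, pass, if_neg hx, if_neg h1]
    refine ⟨hS ▸ h1, hS ▸ arcx, ?_⟩
    rw [hS]
    simp only [spliceArc, pass, if_neg h1, inv, if_neg hx]

/-- Removal of the edge `e`, where the new vertex boundaries pass through `e` as `link` says. -/
noncomputable def splice (G : RibbonGraph α) (e : α) (link : Corner α → Corner α)
    (hl : Corner.IsPairing link) : RibbonGraph α where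
  edges := G.edges.erase e
  arc := G.spliceArc e link
  arc_invol := fun x => by
    by_cases hx : x.1 = e
    · simp [spliceArc, hx]
    · by_cases hE : x.1 ∈ G.edges
      · exact (G.spliceArc_spec e hl hx hE).2.2
      · simp only [G.spliceArc_of_notMem e link hE]
  arc_eq_self_iff := fun x => by
    by_cases hx : x.1 = e
    · simp [spliceArc, hx]
    · by_cases hE : x.1 ∈ G.edges
      · simp [(G.spliceArc_spec e hl hx hE).2.1, hx, hE]
      · simp [G.spliceArc_of_notMem e link hE, hE]
  isolated := G.isolated + G.closedCurves e link

/-- `G ∖ e`. -/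
noncomputable def delete (G : RibbonGraph α) (e : α) : RibbonGraph α :=
  G.splice e Corner.acrossEnd Corner.isPairing_acrossEnd

/-- `G / e`. -/
noncomputable def contract (G : RibbonGraph α) (e : α) : RibbonGraph α :=
  G.splice e Corner.alongSide Corner.isPairing_alongSide

/-! ### Minors -/

open Classical in
/-- The edges that are incident with the vertex `w`. -/
noncomputable def incident (G : RibbonGraph α) (w : G.Vertex) : Finset α :=
  G.edges.filter fun e => ∃ x : G.Corners, x.1.1 = e ∧ w = Sum.inl (Quot.mk _ x)

/-- Removal of an isolated vertex. -/
def dropIsolated (G : RibbonGraph α) : RibbonGraph α :=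
  { G with isolated := G.isolated - 1 }

/-- `G ∖ w` for a vertex `w`: the edges that are incident with `w` are deleted, which makes `w` an
isolated vertex, and then this vertex is removed. -/
noncomputable def deleteVertex (G : RibbonGraph α) (w : G.Vertex) : RibbonGraph α :=
  ((G.incident w).toList.foldl delete G).dropIsolated

/-- Equivalence of ribbon graphs with the same edge labels: a homeomorphism that preserves the
vertices, the edges and their labels acts on the corners of each edge `e` by possibly exchanging
its two ends (`p e`) and possibly exchanging its two sides (`q e`). -/
def Equivalent (G H : RibbonGraph α) : Prop :=
  G.edges = H.edges ∧ G.isolated = H.isolated ∧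
    ∃ p q : α → Bool, ∀ x y : Corner α, x.1 ∈ G.edges → G.arc x = y →
      H.arc (x.1, xor (p x.1) x.2.1, xor (q x.1) x.2.2) =
        (y.1, xor (p y.1) y.2.1, xor (q y.1) y.2.2)

/-- `IsMinor H G`: the ribbon graph `H` is obtained from `G` by a sequence of edge deletions, edge
contractions and vertex deletions, ribbon graphs being considered up to equivalence. -/
inductive IsMinor : RibbonGraph α → RibbonGraph α → Prop
  | refl (G : RibbonGraph α) : IsMinor G G
  | equivalent {H G : RibbonGraph α} (h : IsMinor H G) (H' : RibbonGraph α)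
      (hH : H.Equivalent H') : IsMinor H' G
  | delete {H G : RibbonGraph α} (h : IsMinor H G) (e : α) (he : e ∈ H.edges) :
      IsMinor (H.delete e) G
  | contract {H G : RibbonGraph α} (h : IsMinor H G) (e : α) (he : e ∈ H.edges) :
      IsMinor (H.contract e) G
  | deleteVertex {H G : RibbonGraph α} (h : IsMinor H G) (w : H.Vertex) :
      IsMinor (H.deleteVertex w) G

end RibbonGraph

/-!
The corners of `G`, with the free arcs and a choice of admitted links (across the ends or along the
sides) at each edge, form a graph, and both `f(A)` and `k(G)` count its components: for `f(A)` each
edge admits one link, for `k(G)` both. Removing `e` along the links of type `t` only suppresses the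
corners of `e`, so the components of the new graph of corners, together with the closed curves that
become isolated vertices, are those of the old one with only the links of type `t` admitted at `e`.
Hence `f` of a minor is `f` of `G` at the set obtained by putting `e` in or leaving it out, and only
`k` has to be compared.

If no links are admitted at `e`, every component contains an even number of the four corners of `e`.
So either all four corners become connected once the links of type `t` are admitted, and then `k`
does not change, or the links of type `t` join corners that are already connected while those of the
other type merge two components. In the second case `k` grows by one, and `f(A)` drops by one when
the state of `e` in `A` is switched away from `t`, so that `e` is a loop or a coloop.
-/

section Quotients

variable {X Y : Type*}

theorem mem_iff_mem_of_quot_mk_eq {r : X → X → Prop} {S : Set X} {x y : X}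
    (hS : ∀ x y, r x y → (x ∈ S ↔ y ∈ S)) (h : Quot.mk r x = Quot.mk r y) : x ∈ S ↔ y ∈ S :=
  iff_of_eq (congrArg (Quot.lift (· ∈ S) fun x y hxy => propext (hS x y hxy)) h)

theorem quot_mk_eq_of_le {r s : X → X → Prop} (hrs : r ≤ s) {x y : X}
    (h : Quot.mk r x = Quot.mk r y) : Quot.mk s x = Quot.mk s y :=
  congrArg (Quot.map id hrs) h

theorem card_quot_le_of_le [Finite X] {r s : X → X → Prop} (h : r ≤ s) :
    Nat.card (Quot s) ≤ Nat.card (Quot r) :=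
  Nat.card_le_card_of_surjective (Quot.map id h) (by rintro ⟨x⟩; exact ⟨Quot.mk r x, rfl⟩)

theorem card_quot_congr {r s : X → X → Prop} (hrs : ∀ x y, r x y → Quot.mk s x = Quot.mk s y)
    (hsr : ∀ x y, s x y → Quot.mk r x = Quot.mk r y) : Nat.card (Quot r) = Nat.card (Quot s) :=
  Nat.card_congr
    { toFun := Quot.lift (Quot.mk s) hrs
      invFun := Quot.lift (Quot.mk r) hsr
      left_inv := by rintro ⟨x⟩; rfl
      right_inv := by rintro ⟨x⟩; rfl }

theorem card_quot_eq_add_one [Finite X] {r s : X → X → Prop} {a b : X}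
    (hab : Quot.mk r a ≠ Quot.mk r b) (hs_ab : Quot.mk s a = Quot.mk s b)
    (hrs : ∀ x y, r x y → Quot.mk s x = Quot.mk s y)
    (hsr : ∀ x y, s x y → Quot.mk r x = Quot.mk r y ∨
      (Quot.mk r x = Quot.mk r a ∨ Quot.mk r x = Quot.mk r b) ∧
        (Quot.mk r y = Quot.mk r a ∨ Quot.mk r y = Quot.mk r b)) :
    Nat.card (Quot r) = Nat.card (Quot s) + 1 := by
  classical
  let redirect (c : Quot r) : {c : Quot r // c ≠ Quot.mk r b} :=
    if h : c = Quot.mk r b then ⟨Quot.mk r a, hab⟩ else ⟨c, h⟩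
  have redirect_congr (x y : X) (hxy : s x y) :
      redirect (Quot.mk r x) = redirect (Quot.mk r y) := by
    rcases hsr x y hxy with h | ⟨hx | hx, hy | hy⟩
    · rw [h]
    all_goals simp [redirect, hx, hy, hab]
  have mk_redirect (c : Quot r) :
      Quot.lift (Quot.mk s) hrs (redirect c).1 = Quot.lift (Quot.mk s) hrs c := by
    by_cases h : c = Quot.mk r b
    · simp only [redirect, h, dif_pos, hs_ab]
    · simp only [redirect, dif_neg h]
  have card_compl : Nat.card {c : Quot r // c ≠ Quot.mk r b} = Nat.card (Quot s) :=
    Nat.card_congr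
      { toFun := fun c => Quot.lift (Quot.mk s) hrs c.1
        invFun := Quot.lift (fun x => redirect (Quot.mk r x)) redirect_congr
        left_inv := by rintro ⟨⟨x⟩, hx⟩; exact dif_neg hx
        right_inv := by rintro ⟨x⟩; exact mk_redirect (Quot.mk r x) }
  rw [← Nat.card_congr (Equiv.sumCompl fun c => c = Quot.mk r b), Nat.card_sum, Nat.card_unique,
    card_compl, add_comm]

theorem card_quot_sup_map [Finite X] [Finite Y] (r : X → X → Prop) (s : Y → Y → Prop)
    (ι : Y → X) :
    Nat.card (Quot (r ⊔ Relation.Map s ι ι)) =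
      Nat.card (Quot fun y z => Quot.mk r (ι y) = Quot.mk r (ι z) ∨ s y z) +
        Nat.card {c : Quot r // c ∉ Set.range fun y => Quot.mk r (ι y)} := by
  classical
  let s' (y z : Y) : Prop := Quot.mk r (ι y) = Quot.mk r (ι z) ∨ s y z
  let φ (c : Quot r) : Quot s' ⊕ {c : Quot r // c ∉ Set.range fun y => Quot.mk r (ι y)} :=
    if h : c ∈ Set.range fun y => Quot.mk r (ι y) then .inl (Quot.mk s' h.choose) else .inr ⟨c, h⟩
  have φ_mk (y : Y) : φ (Quot.mk r (ι y)) = .inl (Quot.mk s' y) := by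
    have h : Quot.mk r (ι y) ∈ Set.range fun y => Quot.mk r (ι y) := ⟨y, rfl⟩
    simp only [φ, dif_pos h]
    exact congrArg Sum.inl (Quot.sound (Or.inl h.choose_spec))
  have mk_le {x x' : X} : Quot.mk r x = Quot.mk r x' →
      Quot.mk (r ⊔ Relation.Map s ι ι) x = Quot.mk _ x' :=
    quot_mk_eq_of_le le_sup_left
  rw [← Nat.card_sum]
  exact Nat.card_congr
    { toFun := Quot.lift (fun x => φ (Quot.mk r x)) <| by
        rintro _ _ (h | ⟨y, z, h, rfl, rfl⟩)
        · exact congrArg φ (Quot.sound h)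
        · rw [φ_mk, φ_mk, Quot.sound (show s' y z from Or.inr h)]
      invFun := Sum.elim
        (Quot.lift (fun y => Quot.mk _ (ι y)) fun y z h =>
          h.elim mk_le fun h => Quot.sound (Or.inr ⟨y, z, h, rfl, rfl⟩))
        fun c => Quot.map id (fun _ _ => Or.inl) c.1
      left_inv := by
        rintro ⟨x⟩
        by_cases h : Quot.mk r x ∈ Set.range fun y => Quot.mk r (ι y)
        · simp only [φ, dif_pos h]
          exact mk_le h.choose_spec
        · simp only [φ, dif_neg h]
          rfl
      right_inv := by
        rintro (⟨⟨y⟩⟩ | ⟨⟨x⟩, h⟩)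
        · exact φ_mk y
        · exact dif_neg h }

end Quotients

theorem even_ncard_of_involution {X : Type*} [Finite X] {S : Set X} (σ : X → X)
    (mem : ∀ x ∈ S, σ x ∈ S) (ne : ∀ x ∈ S, σ x ≠ x) (invol : ∀ x ∈ S, σ (σ x) = x) :
    Even S.ncard := by
  have sum_eq_zero : ∑ _x ∈ S.toFinite.toFinset, (1 : ZMod 2) = 0 :=
    Finset.sum_involution (fun x _ => σ x) (fun _ _ => by decide) (by simpa using ne)
      (by simpa using mem) (by simpa using invol)
  simpa [ZMod.natCast_eq_zero_iff_even, ← Set.ncard_eq_toFinset_card] using sum_eq_zero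

namespace Corner

variable {α : Type*}

/-- The two pairings of the corners of an edge: across its ends (`false`), as the curves of `G ∖ e`
run, and along its sides (`true`), as those of `G / e` run. -/
def link : Bool → Corner α → Corner α
  | false => acrossEnd
  | true => alongSide

theorem isPairing_link (t : Bool) : IsPairing (link t : Corner α → Corner α) := by
  cases t
  · exact isPairing_acrossEnd
  · exact isPairing_alongSide

theorem link_not_ne_link (t : Bool) (x : Corner α) : link (!t) x ≠ link t x := by
  obtain ⟨e, i, s⟩ := x
  cases t <;> cases i <;> simp [link, acrossEnd, alongSide]

end Corner

namespace RibbonGraph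

open Corner Function

variable {α : Type*}

instance (G : RibbonGraph α) : Finite G.Corners :=
  Finite.of_injective (β := G.edges × Bool × Bool) (fun x => (⟨x.1.1, x.2⟩, x.1.2)) <| by
    rintro ⟨⟨a, p⟩, ha⟩ ⟨⟨b, q⟩, hb⟩ h
    simp_all

/-! ### Components of the graph of corners -/

theorem arc_mem_edges (G : RibbonGraph α) {x : Corner α} (hx : x.1 ∈ G.edges) :
    (G.arc x).1 ∈ G.edges := by
  by_contra h
  have arc_arc_eq := (G.arc_eq_self_iff _).2 h
  rw [G.arc_invol] at arc_arc_eq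
  exact h (arc_arc_eq ▸ hx)

/-- The free arcs as an involution of the corners of the edges of `G`. -/
def cornerArc (G : RibbonGraph α) (x : G.Corners) : G.Corners := ⟨G.arc x.1, G.arc_mem_edges x.2⟩

/-- The links of type `t` as an involution of the corners of the edges of `G`. -/
def cornerLink (G : RibbonGraph α) (t : Bool) (x : G.Corners) : G.Corners :=
  ⟨link t x.1, ((isPairing_link t).edge x.1).symm ▸ x.2⟩

variable {G : RibbonGraph α}

theorem cornerArc_cornerArc (x : G.Corners) : G.cornerArc (G.cornerArc x) = x :=
  Subtype.ext (G.arc_invol x.1)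

theorem cornerArc_ne (x : G.Corners) : G.cornerArc x ≠ x := fun h =>
  (G.arc_eq_self_iff x.1).1 (congrArg Subtype.val h) x.2

theorem edge_cornerLink (t : Bool) (x : G.Corners) : (G.cornerLink t x).1.1 = x.1.1 :=
  (isPairing_link t).edge x.1

theorem cornerLink_cornerLink (t : Bool) (x : G.Corners) :
    G.cornerLink t (G.cornerLink t x) = x :=
  Subtype.ext ((isPairing_link t).invol x.1)

theorem cornerLink_ne (t : Bool) (x : G.Corners) : G.cornerLink t x ≠ x := fun h =>
  (isPairing_link t).ne x.1 (congrArg Subtype.val h)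

theorem eq_cornerLink_of_edge_eq (t : Bool) {x y : G.Corners} (h : y.1.1 = x.1.1) :
    y = x ∨ y = G.cornerLink t x ∨ y = G.cornerLink (!t) x ∨
      y = G.cornerLink t (G.cornerLink (!t) x) := by
  simpa only [Subtype.ext_iff, cornerLink] using
    (isPairing_link t).eq_or (y := x.1) (y' := link (!t) x.1) (z := y.1) rfl
      ((isPairing_link (!t)).edge x.1) h ((isPairing_link (!t)).ne x.1) (link_not_ne_link t x.1)

/-- One step along a free arc, or along a link admitted by `L`, where `L a` is the set of the
admitted types of links at the edge `a`. -/
def Step (G : RibbonGraph α) (L : α → Set Bool) (x y : G.Corners) : Prop :=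
  y = G.cornerArc x ∨ ∃ t ∈ L x.1.1, y = G.cornerLink t x

/-- The component of a corner in the graph of corners with the free arcs and the links admitted by
`L`. -/
def component (G : RibbonGraph α) (L : α → Set Bool) (x : G.Corners) : Quot (G.Step L) :=
  Quot.mk _ x

/-- The number of components of the graph of corners with the free arcs and the links admitted by
`L`. -/
noncomputable def numComponents (G : RibbonGraph α) (L : α → Set Bool) : ℕ :=
  Nat.card (Quot (G.Step L))

theorem component_cornerArc (L : α → Set Bool) (x : G.Corners) :
    G.component L (G.cornerArc x) = G.component L x :=
  (Quot.sound (r := G.Step L) (.inl rfl)).symm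

theorem component_cornerLink {L : α → Set Bool} {t : Bool} {x : G.Corners} (h : t ∈ L x.1.1) :
    G.component L (G.cornerLink t x) = G.component L x :=
  (Quot.sound (r := G.Step L) (.inr ⟨t, h, rfl⟩)).symm

theorem Step.mono {L L' : α → Set Bool} (h : L ≤ L') : G.Step L ≤ G.Step L' :=
  fun _ _ hxy => hxy.imp_right fun ⟨t, ht, hy⟩ => ⟨t, h _ ht, hy⟩

theorem component_eq_of_le {L L' : α → Set Bool} (h : L ≤ L') {x y : G.Corners}
    (hxy : G.component L x = G.component L y) : G.component L' x = G.component L' y :=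
  quot_mk_eq_of_le (Step.mono h) hxy

theorem numComponents_anti : Antitone G.numComponents := fun _ _ h =>
  card_quot_le_of_le (Step.mono h)

theorem numComponents_congr {L L' : α → Set Bool} (h : ∀ a ∈ G.edges, L a = L' a) :
    G.numComponents L = G.numComponents L' := by
  have step_eq : G.Step L = G.Step L' := by
    ext x y
    rw [Step, Step, h _ x.2]
  rw [numComponents, numComponents, step_eq]

theorem k_eq_numComponents (G : RibbonGraph α) : G.k = G.numComponents ⊤ + G.isolated := by
  have step_eq : G.ComponentStep = G.Step ⊤ := by
    ext x y
    simp [ComponentStep, Step, Subtype.ext_iff, cornerArc, cornerLink, link]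
  rw [k, numComponents, step_eq]

theorem even_ncard_component_inter_edge {L : α → Set Bool} {e : α}
    (hL : ∀ a ≠ e, (L a).Nonempty) (x : G.Corners) :
    Even ({y | G.component L y = G.component L x} ∩ {y | y.1.1 = e}).ncard := by
  choose! type type_mem using hL
  set C : Set G.Corners := {y | G.component L y = G.component L x}
  have even_C : Even C.ncard :=
    even_ncard_of_involution G.cornerArc (fun y hy => (component_cornerArc L y).trans hy)
      (fun y _ => cornerArc_ne y) fun y _ => cornerArc_cornerArc y
  have even_C_diff : Even (C \ {y | y.1.1 = e}).ncard := by
    refine even_ncard_of_involution (fun y => G.cornerLink (type y.1.1) y) ?_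
      (fun y _ => cornerLink_ne _ y) fun y _ => by rw [edge_cornerLink, cornerLink_cornerLink]
    rintro y ⟨hyC, hye⟩
    exact ⟨(component_cornerLink (type_mem _ hye)).trans hyC,
      fun h => hye ((edge_cornerLink _ y).symm.trans h)⟩
  rw [← Set.ncard_inter_add_ncard_sdiff_eq_ncard C {y | y.1.1 = e}, Nat.even_add] at even_C
  exact even_C.2 even_C_diff

theorem exists_ne_component_eq {L : α → Set Bool} {e : α} (hL : ∀ a ≠ e, (L a).Nonempty)
    {x : G.Corners} (hx : x.1.1 = e) :
    ∃ y : G.Corners, y.1.1 = e ∧ y ≠ x ∧ G.component L y = G.component L x := by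
  by_contra! h
  have eq_singleton : {y | G.component L y = G.component L x} ∩ {y | y.1.1 = e} = {x} :=
    Set.eq_singleton_iff_unique_mem.2
      ⟨⟨rfl, hx⟩, fun y hy => by_contra fun hne => h y hy.2 hne hy.1⟩
  simpa [eq_singleton] using even_ncard_component_inter_edge hL x

section Separates

variable [DecidableEq α]

/-- The links of type `t` at `e` leave some of the corners of `e` disconnected, when `L` tells which
links are admitted at the other edges. For `t = false` and `L = ⊤`, this says that `e` is a
bridge. -/
def Separates (G : RibbonGraph α) (L : α → Set Bool) (e : α) (t : Bool) : Prop :=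
  ∀ x : G.Corners, x.1.1 = e → G.component (update L e {t}) (G.cornerLink (!t) x) ≠
    G.component (update L e {t}) x

theorem Separates.anti {L L' : α → Set Bool} {e : α} {t : Bool} (h : G.Separates L' e t)
    (hL : L ≤ L') : G.Separates L e t := fun x hx hxy =>
  h x hx (component_eq_of_le (update_le_update_iff.2 ⟨le_rfl, fun a _ => hL a⟩) hxy)

theorem component_update_cornerLink {L : α → Set Bool} {e : α} {t : Bool} {Q : Set Bool}
    (ht : t ∈ Q) {x : G.Corners} (hx : x.1.1 = e) :
    G.component (update L e Q) (G.cornerLink t x) = G.component (update L e Q) x :=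
  component_cornerLink (by rwa [hx, update_self])

theorem component_update_eq_of_le {L : α → Set Bool} {e : α} {Q Q' : Set Bool} (h : Q ⊆ Q')
    {x y : G.Corners} (hxy : G.component (update L e Q) x = G.component (update L e Q) y) :
    G.component (update L e Q') x = G.component (update L e Q') y :=
  component_eq_of_le (update_mono h) hxy

theorem Step.component_update_eq_or {L : α → Set Bool} {e : α} {Q : Set Bool} {x y : G.Corners}
    (h : G.Step (update L e Q) x y) (Q' : Set Bool) :
    G.component (update L e Q') x = G.component (update L e Q') y ∨
      x.1.1 = e ∧ ∃ t ∈ Q, y = G.cornerLink t x := by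
  rcases h with rfl | ⟨t, ht, rfl⟩
  · exact .inl (component_cornerArc _ x).symm
  · by_cases hx : x.1.1 = e
    · exact .inr ⟨hx, t, by rwa [hx, update_self] at ht, rfl⟩
    · refine .inl (component_cornerLink ?_).symm
      rwa [update_of_ne hx] at ht ⊢

theorem numComponents_update_of_not_separates {L : α → Set Bool} {e : α} {t : Bool}
    (h : ¬ G.Separates L e t) {Q : Set Bool} (ht : t ∈ Q) :
    G.numComponents (update L e {t}) = G.numComponents (update L e Q) := by
  simp only [Separates, not_forall, not_not] at h
  obtain ⟨x, hx, hxx'⟩ := h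
  have connected (y : G.Corners) (hy : y.1.1 = e) :
      G.component (update L e {t}) y = G.component (update L e {t}) x := by
    rcases eq_cornerLink_of_edge_eq t (hy.trans hx.symm) with rfl | rfl | rfl | rfl
    · rfl
    · exact component_update_cornerLink (Set.mem_singleton t) hx
    · exact hxx'
    · rw [component_update_cornerLink (Set.mem_singleton t) ((edge_cornerLink _ x).trans hx), hxx']
  refine card_quot_congr
    (fun y z hyz => component_update_eq_of_le (Set.singleton_subset_iff.2 ht) (Quot.sound hyz))
    fun y z hyz => ?_
  rcases hyz.component_update_eq_or {t} with hyz | ⟨hy, s, -, rfl⟩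
  · exact hyz
  · exact (connected y hy).trans (connected _ ((edge_cornerLink s y).trans hy)).symm

theorem Separates.component_cornerLink {L : α → Set Bool} {e : α} {t : Bool}
    (h : G.Separates L e t) (hL : ∀ a ≠ e, (L a).Nonempty) {x : G.Corners} (hx : x.1.1 = e) :
    G.component (update L e ∅) (G.cornerLink t x) = G.component (update L e ∅) x := by
  have add_links {y z : G.Corners} :
      G.component (update L e ∅) y = G.component (update L e ∅) z →
        G.component (update L e {t}) y = G.component (update L e {t}) z :=
    component_update_eq_of_le (Set.empty_subset _)
  obtain ⟨y, hy, hne, hyx⟩ := exists_ne_component_eq (L := update L e ∅)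
    (fun a ha => by rw [update_of_ne ha]; exact hL a ha) hx
  rcases eq_cornerLink_of_edge_eq t (hy.trans hx.symm) with rfl | rfl | rfl | rfl
  · exact absurd rfl hne
  · exact hyx
  · exact absurd (add_links hyx) (h x hx)
  · refine absurd ?_ (h x hx)
    rw [← component_update_cornerLink (Set.mem_singleton t) ((edge_cornerLink (!t) x).trans hx)]
    exact add_links hyx

theorem Separates.numComponents_update_singleton {L : α → Set Bool} {e : α} {t : Bool}
    (h : G.Separates L e t) (hL : ∀ a ≠ e, (L a).Nonempty) :
    G.numComponents (update L e {t}) = G.numComponents (update L e ∅) := by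
  refine card_quot_congr (fun y z hyz => ?_)
    fun y z hyz => component_update_eq_of_le (Set.empty_subset _) (Quot.sound hyz)
  rcases hyz.component_update_eq_or ∅ with hyz | ⟨hy, s, rfl, rfl⟩
  · exact hyz
  · exact (h.component_cornerLink hL hy).symm

theorem Separates.numComponents_update_empty {L : α → Set Bool} {e : α} {t : Bool}
    (h : G.Separates L e t) (hL : ∀ a ≠ e, (L a).Nonempty) (he : e ∈ G.edges) {Q : Set Bool}
    (hQ : (!t) ∈ Q) :
    G.numComponents (update L e ∅) = G.numComponents (update L e Q) + 1 := by
  let x : G.Corners := ⟨(e, false, false), he⟩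
  let x' := G.cornerLink (!t) x
  have component_eq_or (y : G.Corners) (hy : y.1.1 = e) :
      G.component (update L e ∅) y = G.component (update L e ∅) x ∨
        G.component (update L e ∅) y = G.component (update L e ∅) x' := by
    rcases eq_cornerLink_of_edge_eq t (x := x) hy with rfl | rfl | rfl | rfl
    · exact .inl rfl
    · exact .inl (h.component_cornerLink hL rfl)
    · exact .inr rfl
    · exact .inr (h.component_cornerLink hL (edge_cornerLink _ x))
  have component_ne : G.component (update L e ∅) x ≠ G.component (update L e ∅) x' := fun hxx' =>
    h x rfl (component_update_eq_of_le (Set.empty_subset _) hxx'.symm)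
  have linked : G.component (update L e Q) x = G.component (update L e Q) x' :=
    (component_update_cornerLink (x := x) (e := e) hQ rfl).symm
  refine card_quot_eq_add_one component_ne linked
    (fun y z hyz => component_update_eq_of_le (Set.empty_subset _) (Quot.sound hyz))
    fun y z hyz => (hyz.component_update_eq_or ∅).imp_right ?_
  rintro ⟨hy, s, -, rfl⟩
  exact ⟨component_eq_or y hy, component_eq_or _ ((edge_cornerLink s y).trans hy)⟩

theorem Separates.numComponents_eq_add_one {L : α → Set Bool} {e : α} {t : Bool}
    (h : G.Separates L e t) (hL : ∀ a ≠ e, (L a).Nonempty) (he : e ∈ G.edges) {Q : Set Bool}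
    (hQ : (!t) ∈ Q) :
    G.numComponents (update L e {t}) = G.numComponents (update L e Q) + 1 := by
  rw [h.numComponents_update_singleton hL, h.numComponents_update_empty hL he hQ]

end Separates

/-! ### Splicing out an edge -/

theorem SpliceStep.symm {e : α} {p : Corner α → Corner α} (hp : IsPairing p) {x y : G.Corners}
    (h : G.SpliceStep e p x y) : G.SpliceStep e p y x := by
  rcases h with h | ⟨hx, h⟩
  · exact .inl (by rw [h, G.arc_invol])
  · exact .inr ⟨by rw [h, hp.edge, hx], by rw [h, hp.invol]⟩

variable [DecidableEq α]

theorem pass_mem_edges {e : α} {p : Corner α → Corner α} (hp : IsPairing p) {x : Corner α}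
    (hx : x.1 ∈ G.edges) : (G.pass e p x).1 ∈ G.edges := by
  rw [pass]
  split_ifs
  · exact G.arc_mem_edges ((hp.edge x).symm ▸ hx)
  · exact hx

theorem mk_spliceStep_pass {e : α} {p : Corner α → Corner α} (hp : IsPairing p) (x : G.Corners) :
    Quot.mk (G.SpliceStep e p) ⟨G.pass e p x.1, pass_mem_edges hp x.2⟩ = Quot.mk _ x := by
  by_cases hx : x.1.1 = e
  · let y : G.Corners := ⟨p x.1, (hp.edge x.1).symm ▸ x.2⟩
    have x_to_y : G.SpliceStep e p x y := .inr ⟨hx, rfl⟩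
    have y_to_pass : G.SpliceStep e p y ⟨G.pass e p x.1, pass_mem_edges hp x.2⟩ :=
      .inl (if_pos hx)
    exact ((Quot.sound x_to_y).trans (Quot.sound y_to_pass)).symm
  · simp only [pass, if_neg hx]

theorem mk_spliceStep_spliceArc {e : α} {p : Corner α → Corner α} (hp : IsPairing p)
    {x y : G.Corners} (hx : x.1.1 ≠ e) (h : y.1 = G.spliceArc e p x.1) :
    Quot.mk (G.SpliceStep e p) y = Quot.mk _ x := by
  obtain rfl : y = ⟨G.pass e p (G.pass e p (G.arc x.1)),
      pass_mem_edges hp (pass_mem_edges hp (G.arc_mem_edges x.2))⟩ :=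
    Subtype.ext (h.trans (if_neg hx))
  have x_to_arc : G.SpliceStep e p x (G.cornerArc x) := .inl rfl
  exact (mk_spliceStep_pass hp ⟨_, pass_mem_edges hp (G.arc_mem_edges x.2)⟩).trans <|
    (mk_spliceStep_pass hp (G.cornerArc x)).trans (Quot.sound x_to_arc).symm

/-- The corners that the free arc of `G.splice e p` from `x` visits: those where it arrives along an
arc of `G`, and the other ends of the arcs of `G` at these corners. -/
def spliceTrail (G : RibbonGraph α) (e : α) (p : Corner α → Corner α) (x : Corner α) :
    Set (Corner α) :=
  let W : Set (Corner α) :=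
    {x, G.arc x, G.pass e p (G.arc x), G.pass e p (G.pass e p (G.arc x))}
  W ∪ G.arc ⁻¹' W

theorem arc_mem_spliceTrail {e : α} {p : Corner α → Corner α} {x y : Corner α}
    (h : y ∈ G.spliceTrail e p x) : G.arc y ∈ G.spliceTrail e p x :=
  h.symm.imp id fun h => by rwa [Set.mem_preimage, G.arc_invol]

theorem pairing_mem_spliceTrail {e : α} {p : Corner α → Corner α} (hp : IsPairing p)
    {x y : Corner α} (hx : x.1 ≠ e) (hx' : (G.spliceArc e p x).1 ≠ e) (hy : y.1 = e)
    (h : y ∈ G.spliceTrail e p x) : p y ∈ G.spliceTrail e p x := by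
  have := G.arc_invol
  have := hp.edge
  have := hp.invol
  -- The corner linked to an arrival `z` at `e` is `G.arc (G.pass e p z)`.
  simp only [spliceTrail, Set.mem_union, Set.mem_insert_iff, Set.mem_singleton_iff,
    Set.mem_preimage, spliceArc, if_neg hx] at h hx' ⊢
  grind [pass]

theorem eq_or_eq_spliceArc_of_mem_spliceTrail {e : α} {p : Corner α → Corner α} (hp : IsPairing p)
    {x y : Corner α} (hx : x.1 ≠ e) (hy : y.1 ≠ e) (h : y ∈ G.spliceTrail e p x) :
    y = x ∨ y = G.spliceArc e p x := by
  have := G.arc_invol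
  have := hp.edge
  simp only [spliceTrail, Set.mem_union, Set.mem_insert_iff, Set.mem_singleton_iff,
    Set.mem_preimage, spliceArc, if_neg hx] at h ⊢
  grind [pass]

theorem eq_or_eq_spliceArc_of_mk_eq {e : α} {p : Corner α → Corner α} (hp : IsPairing p)
    {x y : G.Corners} (hx : x.1.1 ≠ e) (hy : y.1.1 ≠ e)
    (h : Quot.mk (G.SpliceStep e p) x = Quot.mk _ y) : y = x ∨ y.1 = G.spliceArc e p x.1 := by
  have mem_of_step {z w : G.Corners} (hzw : G.SpliceStep e p z w)
      (hz : z.1 ∈ G.spliceTrail e p x.1) : w.1 ∈ G.spliceTrail e p x.1 := by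
    rcases hzw with hw | ⟨hze, hw⟩
    · exact hw ▸ arc_mem_spliceTrail hz
    · exact hw ▸ pairing_mem_spliceTrail hp hx (G.spliceArc_spec e hp hx x.2).1 hze hz
  have x_mem : x.1 ∈ G.spliceTrail e p x.1 := .inl (.inl rfl)
  have y_mem : y.1 ∈ G.spliceTrail e p x.1 :=
    (mem_iff_mem_of_quot_mk_eq (S := Subtype.val ⁻¹' G.spliceTrail e p x.1)
      (fun _ _ hzw => ⟨mem_of_step hzw, mem_of_step (hzw.symm hp)⟩) h).1 x_mem
  exact (eq_or_eq_spliceArc_of_mem_spliceTrail hp hx hy y_mem).imp_left Subtype.ext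

/-- The ribbon graph with the edge `e` deleted (`false`) or contracted (`true`). -/
noncomputable def remove (G : RibbonGraph α) (e : α) (t : Bool) : RibbonGraph α :=
  G.splice e (link t) (isPairing_link t)

/-- The corners of the edges that remain when `e` is removed, as corners of the original graph. -/
def cornerOfRemove {e : α} {t : Bool} (x : (G.remove e t).Corners) : G.Corners :=
  ⟨x.1, Finset.mem_of_mem_erase x.2⟩

theorem edge_cornerOfRemove_ne {e : α} {t : Bool} (x : (G.remove e t).Corners) :
    (cornerOfRemove x).1.1 ≠ e :=
  Finset.ne_of_mem_erase x.2

theorem mem_range_cornerOfRemove {e : α} {t : Bool} {x : G.Corners} :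
    x ∈ Set.range (cornerOfRemove (e := e) (t := t)) ↔ x.1.1 ≠ e :=
  ⟨by rintro ⟨y, rfl⟩; exact edge_cornerOfRemove_ne y,
    fun hx => ⟨⟨x.1, Finset.mem_erase.2 ⟨hx, x.2⟩⟩, rfl⟩⟩

theorem step_update_singleton (G : RibbonGraph α) (L : α → Set Bool) (e : α) (t : Bool) :
    G.Step (update L e {t}) = G.SpliceStep e (link t) ⊔
      Relation.Map (fun y z : (G.remove e t).Corners => ∃ u ∈ L y.1.1, z = cornerLink _ u y)
        cornerOfRemove cornerOfRemove := by
  ext x y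
  constructor
  · rintro (rfl | ⟨u, hu, rfl⟩)
    · exact .inl (.inl rfl)
    · by_cases hx : x.1.1 = e
      · rw [hx, update_self] at hu
        exact .inl (.inr ⟨hx, hu ▸ rfl⟩)
      · obtain ⟨x, rfl⟩ := mem_range_cornerOfRemove (t := t).2 hx
        rw [update_of_ne hx] at hu
        exact .inr ⟨x, cornerLink _ u x, ⟨u, hu, rfl⟩, rfl, rfl⟩
  · rintro ((h | ⟨hx, h⟩) | ⟨x, _, ⟨u, hu, rfl⟩, rfl, rfl⟩)
    · exact .inl (Subtype.ext h)
    · exact .inr ⟨t, by rw [hx, update_self]; rfl, Subtype.ext h⟩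
    · exact .inr ⟨u, by rwa [update_of_ne (edge_cornerOfRemove_ne x)], rfl⟩

theorem numComponents_remove (G : RibbonGraph α) (L : α → Set Bool) (e : α) (t : Bool) :
    (G.remove e t).numComponents L = Nat.card (Quot fun y z : (G.remove e t).Corners =>
      Quot.mk (G.SpliceStep e (link t)) (cornerOfRemove y) = Quot.mk _ (cornerOfRemove z) ∨
        ∃ u ∈ L y.1.1, z = cornerLink _ u y) := by
  refine card_quot_congr (fun y z hyz => ?_) fun y z hyz => ?_
  · rcases hyz with rfl | hyz
    · exact Quot.sound <| .inl <|
        (mk_spliceStep_spliceArc (isPairing_link t) (edge_cornerOfRemove_ne y) rfl).symm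
    · exact Quot.sound (.inr hyz)
  · rcases hyz with hyz | hyz
    · rcases eq_or_eq_spliceArc_of_mk_eq (isPairing_link t) (edge_cornerOfRemove_ne y)
        (edge_cornerOfRemove_ne z) hyz with hzy | hzy
      · obtain rfl : z = y := Subtype.ext (congrArg (fun x : G.Corners => x.1) hzy)
        rfl
      · exact Quot.sound (.inl (Subtype.ext hzy))
    · exact Quot.sound (.inr hyz)

theorem closedCurves_eq (G : RibbonGraph α) (e : α) (t : Bool) :
    G.closedCurves e (link t) = Nat.card {c : Quot (G.SpliceStep e (link t)) //
      c ∉ Set.range fun y : (G.remove e t).Corners => Quot.mk _ (cornerOfRemove y)} := by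
  refine Nat.card_congr (Equiv.subtypeEquivRight fun c => ?_)
  constructor
  · rintro h ⟨y, hy⟩
    exact edge_cornerOfRemove_ne y (h _ hy)
  · rintro h x rfl
    by_contra hx
    obtain ⟨y, rfl⟩ := mem_range_cornerOfRemove (t := t).2 hx
    exact h ⟨y, rfl⟩

theorem numComponents_update_singleton (G : RibbonGraph α) (L : α → Set Bool) (e : α) (t : Bool) :
    G.numComponents (update L e {t}) =
      (G.remove e t).numComponents L + G.closedCurves e (link t) := by
  rw [numComponents, step_update_singleton, card_quot_sup_map, numComponents_remove,
    closedCurves_eq]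

end RibbonGraph

namespace SetSystem

variable {α : Type*} [DecidableEq α]

/-- The set `A` with `e` put in (`true`) or left out (`false`). -/
def setMem (e : α) (t : Bool) (A : Finset α) : Finset α := if t then insert e A else A.erase e

theorem mem_setMem {e a : α} {t : Bool} {A : Finset α} :
    a ∈ setMem e t A ↔ if a = e then t = true else a ∈ A := by
  cases t <;> by_cases a = e <;> simp_all [setMem]

theorem setMem_decide (e : α) (A : Finset α) : setMem e (decide (e ∈ A)) A = A := by
  ext a
  rw [mem_setMem]
  split_ifs with h
  · rw [h, decide_eq_true_iff]
  · rfl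

theorem setMem_subset_iff {e : α} {t : Bool} {A E : Finset α} (he : e ∈ E) :
    setMem e t A ⊆ E ↔ A ⊆ E := by
  cases t
  · exact Finset.erase_subset_iff_of_mem he
  · exact Finset.insert_subset_iff.trans (and_iff_right he)

/-- The feasible sets that contain `e` (`true`) or avoid it (`false`), restricted to the complement
of `e`. -/
def side (D : SetSystem α) (e : α) : Bool → SetSystem α
  | false => D.avoiding e
  | true => D.through e

theorem ground_side (D : SetSystem α) (e : α) (t : Bool) :
    (D.side e t).ground = D.ground.erase e := by
  cases t <;> rfl

theorem mem_feasible_side {D : SetSystem α} {e : α} {t : Bool} {A : Finset α} :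
    A ∈ (D.side e t).feasible ↔ e ∉ A ∧ setMem e t A ∈ D.feasible := by
  cases t
  · refine ⟨fun ⟨hA, hAe⟩ => ?_, fun ⟨he, hA⟩ => ?_⟩
    · have he : e ∉ A := (Finset.subset_erase.1 hAe).2
      exact ⟨he, show A.erase e ∈ _ by rwa [Finset.erase_eq_of_notMem he]⟩
    · have hA' : A ∈ D.feasible := Finset.erase_eq_of_notMem he ▸ hA
      exact ⟨hA', Finset.subset_erase.2 ⟨D.subset_ground A hA', he⟩⟩
  · constructor
    · rintro ⟨F, hF, he, rfl⟩
      exact ⟨Finset.notMem_erase e F,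
        show insert e (F.erase e) ∈ _ by rwa [Finset.insert_erase he]⟩
    · rintro ⟨he, hA⟩
      exact ⟨_, hA, Finset.mem_insert_self e A, (Finset.erase_insert he).symm⟩

/-- Deletion (`false`) or contraction (`true`) of an element. -/
noncomputable def remove (D : SetSystem α) (e : α) : Bool → SetSystem α
  | false => D.delete e
  | true => D.contract e

theorem remove_eq_side {D : SetSystem α} {e : α} {t : Bool} {F : Finset α} (hF : F ∈ D.feasible)
    (h : decide (e ∈ F) = t) : D.remove e t = D.side e t := by
  cases t
  · exact if_neg fun he => of_decide_eq_false h (he.2 F hF)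
  · exact if_neg fun he => he.2 F hF (of_decide_eq_true h)

theorem remove_eq_side_not {D : SetSystem α} {e : α} {t : Bool} (he : e ∈ D.ground)
    (h : ∀ F ∈ D.feasible, decide (e ∈ F) = !t) : D.remove e t = D.side e (!t) := by
  cases t
  · exact if_pos ⟨he, fun F hF => of_decide_eq_true (h F hF)⟩
  · exact if_pos ⟨he, fun F hF => of_decide_eq_false (h F hF)⟩

end SetSystem

namespace RibbonGraph

open Corner Function SetSystem

variable {α : Type*}

/-! ### Delta-matroids of minors -/

/-- The links along which the boundary of `(V, A)` runs. -/
def boundaryLinks (A : Finset α) (a : α) : Set Bool := {t | t = true ↔ a ∈ A}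

theorem boundaryLinks_nonempty (A : Finset α) (a : α) : (boundaryLinks A a).Nonempty := by
  classical
  exact ⟨decide (a ∈ A), decide_eq_true_iff⟩

theorem f_eq_numComponents (G : RibbonGraph α) (A : Finset α) :
    G.f A = G.numComponents (boundaryLinks A) + G.isolated := by
  have step_eq : G.BoundaryStep A = G.Step (boundaryLinks A) := by
    ext x y
    by_cases hx : x.1.1 ∈ A <;>
      simp [BoundaryStep, Step, boundaryLinks, hx, Subtype.ext_iff, cornerArc, cornerLink, link]
  rw [f, numComponents, step_eq]

theorem k_le_f (G : RibbonGraph α) (A : Finset α) : G.k ≤ G.f A := by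
  rw [k_eq_numComponents, f_eq_numComponents]
  exact Nat.add_le_add_right (numComponents_anti le_top) _

section Removal

variable [DecidableEq α] {G : RibbonGraph α}

theorem boundaryLinks_setMem (e : α) (t : Bool) (A : Finset α) :
    boundaryLinks (setMem e t A) = update (boundaryLinks A) e {t} := by
  ext a : 1
  by_cases ha : a = e
  · subst ha
    ext s
    cases s <;> cases t <;> simp [boundaryLinks, mem_setMem]
  · simp [boundaryLinks, mem_setMem, ha]

theorem f_remove (G : RibbonGraph α) (e : α) (t : Bool) (A : Finset α) :
    (G.remove e t).f A = G.f (setMem e t A) := by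
  rw [f_eq_numComponents, f_eq_numComponents, boundaryLinks_setMem, numComponents_update_singleton,
    add_assoc, add_comm (G.closedCurves _ _)]
  rfl

theorem k_remove (G : RibbonGraph α) (e : α) (t : Bool) :
    (G.remove e t).k = G.numComponents (update ⊤ e {t}) + G.isolated := by
  rw [k_eq_numComponents, numComponents_update_singleton, add_assoc, add_comm (G.closedCurves _ _)]
  rfl

theorem k_remove_of_not_separates {e : α} {t : Bool} (h : ¬ G.Separates ⊤ e t) :
    (G.remove e t).k = G.k := by
  rw [k_remove, k_eq_numComponents, numComponents_update_of_not_separates h (Set.mem_univ t)]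
  exact congrArg (G.numComponents · + _) (update_eq_self e ⊤)

theorem Separates.k_remove {e : α} {t : Bool} (h : G.Separates ⊤ e t) (he : e ∈ G.edges) :
    (G.remove e t).k = G.k + 1 := by
  rw [RibbonGraph.k_remove, k_eq_numComponents,
    h.numComponents_eq_add_one (fun _ _ => Set.univ_nonempty) he (Set.mem_univ _), add_right_comm]
  exact congrArg (G.numComponents · + _ + 1) (update_eq_self e ⊤)

theorem Separates.f_setMem {e : α} {t : Bool} (h : G.Separates ⊤ e t) (he : e ∈ G.edges)
    (A : Finset α) : G.f (setMem e t A) = G.f (setMem e (!t) A) + 1 := by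
  rw [f_eq_numComponents, f_eq_numComponents, boundaryLinks_setMem, boundaryLinks_setMem,
    (h.anti (L := boundaryLinks A) le_top).numComponents_eq_add_one
      (fun a _ => boundaryLinks_nonempty A a) he (Set.mem_singleton (!t)), add_right_comm]

theorem exists_not_separates {e : α} (he : e ∈ G.edges) : ∃ t, ¬ G.Separates ⊤ e t := by
  by_contra! h
  have f_true := (h true).f_setMem he ∅
  have f_false := (h false).f_setMem he ∅
  simp only [Bool.not_true, Bool.not_false] at f_true f_false
  omega

theorem D_remove_eq_side {e : α} {t s : Bool} (he : e ∈ G.edges)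
    (h : ∀ A, (G.remove e t).f A = (G.remove e t).k ↔ G.f (setMem e s A) = G.k) :
    (G.remove e t).D = G.D.side e s := by
  refine SetSystem.ext (ground_side G.D e s).symm (Set.ext fun A => ?_)
  rw [mem_feasible_side]
  change A ⊆ G.edges.erase e ∧ _ ↔ e ∉ A ∧ setMem e s A ⊆ G.edges ∧ _
  rw [Finset.subset_erase, setMem_subset_iff he, h, and_assoc, and_left_comm]

theorem D_remove_of_not_separates {e : α} {t : Bool} (he : e ∈ G.edges)
    (h : ¬ G.Separates ⊤ e t) : (G.remove e t).D = G.D.side e t :=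
  D_remove_eq_side he fun _ => by rw [f_remove, k_remove_of_not_separates h]

theorem Separates.D_remove {e : α} {t : Bool} (h : G.Separates ⊤ e t) (he : e ∈ G.edges) :
    (G.remove e t).D = G.D.side e (!t) :=
  D_remove_eq_side he fun _ => by
    rw [f_remove, h.f_setMem he, h.k_remove he, Nat.add_right_cancel_iff]

theorem Separates.decide_mem_of_feasible {e : α} {t : Bool} (h : G.Separates ⊤ e t)
    (he : e ∈ G.edges) {F : Finset α} (hF : F ∈ G.D.feasible) : decide (e ∈ F) = !t := by
  rw [Bool.eq_not]
  rintro rfl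
  have f_F : G.f F = G.f (setMem e (!decide (e ∈ F)) F) + 1 := by
    rw [← h.f_setMem he, setMem_decide]
  have k_lt : G.k < G.f F := f_F ▸ Nat.lt_succ_of_le (G.k_le_f _)
  exact k_lt.ne' hF.2

end Removal

theorem feasible_D_nonempty (G : RibbonGraph α) : G.D.feasible.Nonempty := by
  classical
  induction hn : G.edges.card generalizing G with
  | zero =>
    have edges_eq : G.edges = ∅ := Finset.card_eq_zero.1 hn
    refine ⟨∅, Finset.empty_subset _, ?_⟩
    rw [f_eq_numComponents, k_eq_numComponents, numComponents_congr (L' := ⊤) (by simp [edges_eq])]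
  | succ n ih =>
    obtain ⟨e, he⟩ : G.edges.Nonempty := Finset.card_pos.1 (by omega)
    obtain ⟨t, ht⟩ := exists_not_separates he
    have card_edges : (G.remove e t).edges.card = n :=
      (Finset.card_erase_of_mem he).trans (by omega)
    obtain ⟨A, hA⟩ := ih (G.remove e t) card_edges
    rw [D_remove_of_not_separates he ht] at hA
    exact ⟨_, (mem_feasible_side.1 hA).2⟩

theorem D_remove [DecidableEq α] (G : RibbonGraph α) {e : α} (he : e ∈ G.edges)
    (t : Bool) : (G.remove e t).D = G.D.remove e t := by
  by_cases h : G.Separates ⊤ e t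
  · rw [h.D_remove he, remove_eq_side_not he fun F hF => h.decide_mem_of_feasible he hF]
  · obtain ⟨A, hA⟩ := (G.remove e t).feasible_D_nonempty
    have D_eq := D_remove_of_not_separates he h
    rw [D_eq] at hA ⊢
    exact (remove_eq_side (mem_feasible_side.1 hA).2 (by simp [mem_setMem])).symm

theorem D_delete [DecidableEq α] (G : RibbonGraph α) {e : α} (he : e ∈ G.edges) :
    (G.delete e).D = G.D.delete e :=
  G.D_remove he false

theorem D_contract [DecidableEq α] (G : RibbonGraph α) {e : α} (he : e ∈ G.edges) :
    (G.contract e).D = G.D.contract e :=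
  G.D_remove he true

theorem D_dropIsolated (G : RibbonGraph α) : G.dropIsolated.D = G.D :=
  SetSystem.ext rfl <| Set.ext fun _ => and_congr_right fun _ =>
    (Nat.add_right_cancel_iff (n := G.isolated - 1)).trans Nat.add_right_cancel_iff.symm

theorem Equivalent.numComponents_eq {G H : RibbonGraph α} (h : G.Equivalent H)
    (L : α → Set Bool) : G.numComponents L = H.numComponents L := by
  obtain ⟨edges_eq, -, p, q, arc_eq⟩ := h
  let φ (x : Corner α) : Corner α := (x.1, xor (p x.1) x.2.1, xor (q x.1) x.2.2)
  have φ_φ (x : Corner α) : φ (φ x) = x := by simp [φ]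
  have φ_link (t : Bool) (x : Corner α) : φ (link t x) = link t (φ x) := by
    cases t <;> simp [φ, link, acrossEnd, alongSide]
  have φ_arc (x : G.Corners) : φ (G.arc x.1) = H.arc (φ x.1) := (arc_eq x.1 _ x.2 rfl).symm
  let ε : G.Corners ≃ H.Corners :=
    { toFun := fun x => ⟨φ x.1, edges_eq.subset x.2⟩
      invFun := fun x => ⟨φ x.1, edges_eq.superset x.2⟩
      left_inv := fun x => Subtype.ext (φ_φ x.1)
      right_inv := fun x => Subtype.ext (φ_φ x.1) }
  have ε_cornerArc (x : G.Corners) : H.cornerArc (ε x) = ε (G.cornerArc x) :=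
    Subtype.ext (φ_arc x).symm
  have ε_cornerLink (t : Bool) (x : G.Corners) : H.cornerLink t (ε x) = ε (G.cornerLink t x) :=
    Subtype.ext (φ_link t x.1).symm
  refine Nat.card_congr (Quot.congr ε fun x y => ?_)
  rw [Step, Step, ε_cornerArc, ε.apply_eq_iff_eq]
  simp only [ε_cornerLink, ε.apply_eq_iff_eq]
  rfl

theorem Equivalent.D_eq {G H : RibbonGraph α} (h : G.Equivalent H) : H.D = G.D := by
  refine SetSystem.ext h.1.symm (Set.ext fun A => ?_)
  change A ⊆ H.edges ∧ H.f A = H.k ↔ A ⊆ G.edges ∧ G.f A = G.k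
  rw [h.1, f_eq_numComponents, f_eq_numComponents, k_eq_numComponents, k_eq_numComponents,
    h.numComponents_eq, h.numComponents_eq, h.2.1]

theorem isMinor_D_foldl_delete [DecidableEq α] {D : SetSystem α} (l : List α) (G : RibbonGraph α)
    (hG : G.D.IsMinor D) (hl : l.Nodup) (hlG : ∀ e ∈ l, e ∈ G.edges) :
    (l.foldl RibbonGraph.delete G).D.IsMinor D := by
  induction l generalizing G with
  | nil => exact hG
  | cons e l ih =>
    obtain ⟨he, hlG⟩ := List.forall_mem_cons.1 hlG
    obtain ⟨hel, hl⟩ := List.nodup_cons.1 hl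
    refine ih (G.delete e) ?_ hl fun a ha => ?_
    · rw [G.D_delete he]
      exact hG.delete e he
    · exact Finset.mem_erase.2 ⟨fun hae => hel (hae ▸ ha), hlG a ha⟩

theorem IsMinor.isMinor_D [DecidableEq α] {G H : RibbonGraph α} (h : H.IsMinor G) :
    H.D.IsMinor G.D := by
  induction h with
  | refl G => exact .refl _
  | equivalent _ H' hH ih => rwa [hH.D_eq]
  | delete _ e he ih =>
    rw [D_delete _ he]
    exact ih.delete e he
  | contract _ e he ih =>
    rw [D_contract _ he]
    exact ih.contract e he
  | @deleteVertex H _ _ w ih =>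
    rw [RibbonGraph.deleteVertex, D_dropIsolated]
    refine isMinor_D_foldl_delete _ _ ih (Finset.nodup_toList _) fun e he => ?_
    classical
    exact Finset.filter_subset _ _ (Finset.mem_toList.1 he)

end RibbonGraph

theorem propositionp {α : Type*} [DecidableEq α] (G : RibbonGraph α) :
    (∀ e ∈ G.edges, (G.delete e).D = G.D.delete e ∧ (G.contract e).D = G.D.contract e) ∧
      ∀ H : RibbonGraph α, H.IsMinor G → H.D.IsMinor G.D :=
  ⟨fun _ he => ⟨G.D_delete he, G.D_contract he⟩, fun _ hH => hH.isMinor_D⟩
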